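/- **Setting.** All indices $n,m$ run over $\mathbb Z_{\ge 0}$. Let $(f_1,f_2)$ be formal Laurent series at infinity, $f_j(z)=\sum_{k\ge 0}s_{j,k}z^{-k-1}$ with $s_{j,k}\in\mathbb C$. A polynomial $P$ with $\deg P\le n+m$ solves the (type II) Hermite–Padé problem for the index $(n,m)$ if there are polynomials $Q_1,Q_2$ with $f_1P-Q_1=O(z^{-n-1})$ and $f_2P-Q_2=O(z^{-m-1})$. The index $(n,m)$ is normal if the solution is unique up to a multiplicative constant and every nonzero solution has degree exactly $n+m$; the pair $(f_1,f_2)$ is a perfect system if all indices are normal, and then $P_{n,m}$ denotes the monic solution (the Hermite–Padé polynomial). The recurrence relations with coefficients $a,b,c,d$ are $$P_{n+1,m}=(x-c_{n,m})P_{n,m}-a_{n,m}P_{n-1,m}-b_{n,m}P_{n,m-1},$$ $$P_{n,m+1}=(x-d_{n,m})P_{n,m}-a_{n,m}P_{n-1,m}-b_{n,m}P_{n,m-1},$$ with $a_{0,m}=b_{n,0}=0$, $a_{n,m}\ne0$ for $n\ge1$ and $b_{n,m}\neq 0$ for $m\ge1$ (terms with an index $-1$ are absent). For complex arrays $\alpha^{(1)},\dots,\alpha^{(5)},\beta^{(1)}$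 consider the transition matrices $$L_{n,m}=\begin{pmatrix}x+\alpha^{(1)}_{n,m}&\alpha^{(2)}_{n,m}&\alpha^{(3)}_{n,m}\\ \alpha^{(4)}_{n+1,m}&0&0\\ \alpha^{(5)}_{n+1,m}&0&1\end{pmatrix},\qquad M_{n,m}=\begin{pmatrix}x+\beta^{(1)}_{n,m}&\alpha^{(2)}_{n,m}&\alpha^{(3)}_{n,m}\\ \alpha^{(4)}_{n,m+1}&1&0\\ \alpha^{(5)}_{n,m+1}&0&0\end{pmatrix},$$ and put $$c_{n,m}=-\alpha^{(1)}_{n,m},\quad d_{n,m}=-\beta^{(1)}_{n,m},\quad a_{n,m}=-\alpha^{(4)}_{n,m}\alpha^{(2)}_{n,m},\quad b_{n,m}=-\alpha^{(5)}_{n,m}\alpha^{(3)}_{n,m}.\qquad(*)$$ The family is called admissible if all $L_{n,m},M_{n,m}$ are invertible and $a_{0,m}=0=b_{n,0}$ for all $n,m$. The entries are said to correspond to a pair $(f_1,f_2)$ if its monic Hermite–Padé polynomials $P_{n,m}$ satisfy the recurrence relations with the coefficients $(*)$ and, for some nonzero constants $p_n,q_m$ (a rescaling of the rows of the wave function), $$\alpha^{(2)}_{n,m}=\frac{h^{(1)}_{n,m}}{p_n},\quad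 \alpha^{(3)}_{n,m}=\frac{h^{(2)}_{n,m}}{q_m},\quad \alpha^{(4)}_{n+1,m}=-\frac{p_{n+1}}{h^{(1)}_{n,m}},\quad \alpha^{(5)}_{n,m+1}=-\frac{q_{m+1}}{h^{(2)}_{n,m}},$$ where $h^{(1)}_{n,m}\ne0$ is the coefficient of $z^{-n-1}$ in $f_1P_{n,m}$ and $h^{(2)}_{n,m}\neq 0$ is the coefficient of $z^{-m-1}$ in $f_2P_{n,m}$. **Theorem 1.** (i) For every admissible family, the discrete zero curvature condition $L_{n,m+1}M_{n,m}=M_{n+1,m}L_{n,m}$ holds for all $n,m$ if and only if there is a perfect system $(f_1,f_2)$ to which the entries correspond. (ii) Let $a,b,c,d$ be arrays of complex numbers. There is an admissible family that satisfies the zero curvature condition and has the coefficients $a,b,c,d$ in $(*)$ if and only if there is a perfect system $(f_1,f_2)$ whose monic Hermite–Padé polynomials satisfy the recurrence relations with the coefficients $a,b,c,d$. (iii) For every perfect system there is an admissible family satisfying the zero curvature condition whose entries correspond to it; in particular its Hermite–Padé polynomials satisfy recurrence relations of the above form. -/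

import Mathlib

open Polynomial

noncomputable section

namespace HermitePade

/-! ### Hermite-Padé polynomials of type II

Laurent series at infinity are modelled by `LaurentSeries ℂ` in the local parameter `t = 1 / z`:
the coefficient of `z ^ (-k)` is the coefficient at `k : ℤ`. -/

/-- The formal Laurent series `f(z) = ∑_{k ≥ 0} s k / z ^ (k + 1)` at infinity. -/
def laurentAtInfty (s : ℕ → ℂ) : LaurentSeries ℂ :=
  HahnSeries.ofPowerSeries ℤ ℂ (PowerSeries.X * PowerSeries.mk s)

/-- A polynomial in `z`, seen as a Laurent series at infinity. -/
def polyAtInfty (P : ℂ[X]) : LaurentSeries ℂ :=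
  Polynomial.aeval (HahnSeries.single (-1 : ℤ) (1 : ℂ) : LaurentSeries ℂ) P

/-- `g = O(1 / z ^ N)` as `z → ∞`, for a formal Laurent series `g` at infinity. -/
def IsBigOInfty (g : LaurentSeries ℂ) (N : ℕ) : Prop :=
  ∀ k : ℤ, k < (N : ℤ) → g.coeff k = 0

/-- `P` solves the Hermite-Padé problem with multi-index `(n, m)` for the pair of series with
coefficients `s 0`, `s 1`. The trivial solution `P = 0` is allowed here. -/
def IsSolution (s : Fin 2 → ℕ → ℂ) (n m : ℕ) (P : ℂ[X]) : Prop :=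
  P.natDegree ≤ n + m ∧
  (∃ Q : ℂ[X],
    IsBigOInfty (laurentAtInfty (s 0) * polyAtInfty P - polyAtInfty Q) (n + 1)) ∧
  (∃ Q : ℂ[X],
    IsBigOInfty (laurentAtInfty (s 1) * polyAtInfty P - polyAtInfty Q) (m + 1))

/-- The multi-index `(n, m)` is normal: solutions are unique up to a multiplicative constant, and
every nontrivial solution has full degree `n + m`. -/
def IsNormal (s : Fin 2 → ℕ → ℂ) (n m : ℕ) : Prop :=
  (∀ P P' : ℂ[X], IsSolution s n m P → IsSolution s n m P' → P ≠ 0 →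
    ∃ r : ℂ, P' = Polynomial.C r * P) ∧
  (∀ P : ℂ[X], IsSolution s n m P → P ≠ 0 → P.natDegree = n + m)

/-- The pair of series is a perfect system: all multi-indices are normal. -/
def IsPerfect (s : Fin 2 → ℕ → ℂ) : Prop :=
  ∀ n m : ℕ, IsNormal s n m

/-- `P` is the table of the monic Hermite-Padé polynomials of the pair of series. -/
def IsHermitePadeTable (s : Fin 2 → ℕ → ℂ) (P : ℕ → ℕ → ℂ[X]) : Prop :=
  ∀ n m : ℕ, (P n m).Monic ∧ IsSolution s n m (P n m)

/-- The nearest neighbour recurrence relations with coefficients `a, b, c, d`. At `n = 0` (resp.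
`m = 0`) the term with index `n - 1` (resp. `m - 1`) is absent, since `a 0 m = 0`
(resp. `b n 0 = 0`). -/
def SatisfiesRecurrences (a b c d : ℕ → ℕ → ℂ) (P : ℕ → ℕ → ℂ[X]) : Prop :=
  (∀ m, a 0 m = 0) ∧ (∀ n, b n 0 = 0) ∧
  (∀ n m, 1 ≤ n → a n m ≠ 0) ∧ (∀ n m, 1 ≤ m → b n m ≠ 0) ∧
  (∀ n m, P (n + 1) m = (X - C (c n m)) * P n m - C (a n m) * P (n - 1) m
    - C (b n m) * P n (m - 1)) ∧
  (∀ n m, P n (m + 1) = (X - C (d n m)) * P n m - C (a n m) * P (n - 1) m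
    - C (b n m) * P n (m - 1))

/-! ### Transition matrices -/

/-- The scalar entries of a family of transition matrices, indexed by the quarter lattice. -/
structure Entries where
  α₁ : ℕ → ℕ → ℂ
  β₁ : ℕ → ℕ → ℂ
  α₂ : ℕ → ℕ → ℂ
  α₃ : ℕ → ℕ → ℂ
  α₄ : ℕ → ℕ → ℂ
  α₅ : ℕ → ℕ → ℂ

namespace Entries

/-- The transition matrix from `(n, m)` to `(n + 1, m)`. -/
def L (T : Entries) (n m : ℕ) : Matrix (Fin 3) (Fin 3) ℂ[X] :=
  !![X + C (T.α₁ n m), C (T.α₂ n m), C (T.α₃ n m);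
     C (T.α₄ (n + 1) m), 0, 0;
     C (T.α₅ (n + 1) m), 0, 1]

/-- The transition matrix from `(n, m)` to `(n, m + 1)`. -/
def M (T : Entries) (n m : ℕ) : Matrix (Fin 3) (Fin 3) ℂ[X] :=
  !![X + C (T.β₁ n m), C (T.α₂ n m), C (T.α₃ n m);
     C (T.α₄ n (m + 1)), 1, 0;
     C (T.α₅ n (m + 1)), 0, 0]

/-- The discrete zero curvature condition. -/
def ZeroCurvature (T : Entries) : Prop :=
  ∀ n m : ℕ, T.L n (m + 1) * T.M n m = T.M (n + 1) m * T.L n m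

/-- The recurrence coefficient `a` attached to the entries. -/
def a (T : Entries) (n m : ℕ) : ℂ := -(T.α₄ n m * T.α₂ n m)

/-- The recurrence coefficient `b` attached to the entries. -/
def b (T : Entries) (n m : ℕ) : ℂ := -(T.α₅ n m * T.α₃ n m)

/-- The recurrence coefficient `c` attached to the entries. -/
def c (T : Entries) (n m : ℕ) : ℂ := -T.α₁ n m

/-- The recurrence coefficient `d` attached to the entries. -/
def d (T : Entries) (n m : ℕ) : ℂ := -T.β₁ n m

/-- The matrices are invertible (for every value of the spectral variable; their determinants are
constant), and the boundary conditions `a 0 m = 0 = b n 0` hold. -/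
def Admissible (T : Entries) : Prop :=
  (∀ n m, IsUnit (T.L n m)) ∧ (∀ n m, IsUnit (T.M n m)) ∧
  (∀ m, T.a 0 m = 0) ∧ (∀ n, T.b n 0 = 0)

end Entries

/-- The coefficient of `1 / z ^ (k + 1)` in `f(z) P(z)`, where `f` has the coefficients `s`;
equivalently `∑ i, (coefficient of x ^ i in P) * s (i + k)`. For a solution with multi-index
`(n, m)` and `k = n`, `s = s 0` (or `k = m`, `s = s 1`) it is the leading coefficient of the
remainder. -/
def remainderCoeff (s : ℕ → ℂ) (P : ℂ[X]) (k : ℕ) : ℂ :=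
  (laurentAtInfty s * polyAtInfty P).coeff ((k : ℤ) + 1)

/-- The off-diagonal entries are the ones given by the Hermite-Padé polynomials `P` of the pair of
series, up to a rescaling `diag (1, p n, q m)` of the rows of the wave function. -/
def EntriesFromSeries (T : Entries) (s : Fin 2 → ℕ → ℂ) (P : ℕ → ℕ → ℂ[X]) : Prop :=
  ∃ p q : ℕ → ℂ, (∀ n, p n ≠ 0) ∧ (∀ m, q m ≠ 0) ∧
    (∀ n m, remainderCoeff (s 0) (P n m) n ≠ 0) ∧
    (∀ n m, remainderCoeff (s 1) (P n m) m ≠ 0) ∧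
    (∀ n m, T.α₂ n m = remainderCoeff (s 0) (P n m) n / p n) ∧
    (∀ n m, T.α₃ n m = remainderCoeff (s 1) (P n m) m / q m) ∧
    (∀ n m, T.α₄ (n + 1) m = -(p (n + 1) / remainderCoeff (s 0) (P n m) n)) ∧
    (∀ n m, T.α₅ n (m + 1) = -(q (m + 1) / remainderCoeff (s 1) (P n m) m))

/-- The entries correspond to the pair of series: its monic Hermite-Padé polynomials satisfy the
recurrence relations with the coefficients `a, b, c, d` attached to the entries, and the entries
are expressed through the series. -/
def Corresponds (T : Entries) (s : Fin 2 → ℕ → ℂ) : Prop :=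
  ∃ P : ℕ → ℕ → ℂ[X], IsHermitePadeTable s P ∧
    SatisfiesRecurrences T.a T.b T.c T.d P ∧ EntriesFromSeries T s P

end HermitePade

end

noncomputable section

namespace HermitePade

/-! ### The moment functional -/

/-! Pairing with powers of `X` turns the order conditions into orthogonality for two moment
functionals (`isSolution_iff`), and the leading remainder coefficients h¹, h² into the first moments
not forced to vanish. Perfectness makes them nonzero.

For a perfect system, X P_{n,m} minus a next neighbour and suitable multiples of P_{n-1,m} and
P_{n,m-1} again solves the (n,m) problem, so it is a multiple of P_{n,m}; this yields the
recurrences (`IsPerfect.exists_recurrences`). Comparing the two routes to P_{n+1,m+1} gives the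
(0,0) entry of zero curvature (`SatisfiesRecurrences.compatible`); the other entries express how h¹
and h² change along a lattice step.

Conversely, zero curvature makes the wave function path independent, so its first component obeys
the recurrences, and it forces c ≠ d. The functional that is 1 on P_{0,0} and 0 on the other P_{n,0}
is then orthogonal in the required way on the whole lattice, with h¹ ≠ 0 because c ≠ d and a ≠ 0
(`SatisfiesRecurrences.exists_moment`). Exchanging the indices gives the second functional.
Orthogonality with nonzero h¹, h² forces normality (`IsHermitePadeTable.isPerfect`), and the ratios
h¹/α₂ and h²/α₃ turn out to depend on n alone and on m alone: they are the rescaling constants. -/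

/-- The linear functional on polynomials with moments `s`. -/
def moment (s : ℕ → ℂ) : ℂ[X] →ₗ[ℂ] ℂ :=
  (Polynomial.basisMonomials ℂ).constr ℂ s

@[simp]
theorem moment_X_pow (s : ℕ → ℂ) (k : ℕ) : moment s (X ^ k) = s k := by
  have h := (Polynomial.basisMonomials ℂ).constr_basis ℂ s k
  rw [Polynomial.coe_basisMonomials] at h
  rw [← monomial_one_right_eq_X_pow]
  exact h

theorem moment_C_mul (s : ℕ → ℂ) (r : ℂ) (P : ℂ[X]) : moment s (C r * P) = r * moment s P := by
  rw [← smul_eq_C_mul, map_smul, smul_eq_mul]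

/-- Used to turn a functional prescribed on some other basis into a sequence of series coefficients.
-/
theorem moment_eq_of_X_pow {ℓ : ℂ[X] →ₗ[ℂ] ℂ} : moment (fun k => ℓ (X ^ k)) = ℓ := by
  ext k
  simp [monomial_one_right_eq_X_pow]

/-! ### Series at infinity -/

theorem polyAtInfty_monomial (i : ℕ) (c : ℂ) :
    polyAtInfty (C c * X ^ i) = HahnSeries.single (-(i : ℤ)) c := by
  simp only [polyAtInfty, map_mul, aeval_C, map_pow, aeval_X, HahnSeries.single_pow, one_pow]
  rw [HahnSeries.algebraMap_apply', ← PowerSeries.C_eq_algebraMap, HahnSeries.ofPowerSeries_C,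
    HahnSeries.C_apply, HahnSeries.single_mul_single]
  simp

theorem polyAtInfty_add (P Q : ℂ[X]) : polyAtInfty (P + Q) = polyAtInfty P + polyAtInfty Q :=
  map_add _ P Q

theorem coeff_polyAtInfty_of_pos (P : ℂ[X]) {k : ℤ} (hk : 0 < k) : (polyAtInfty P).coeff k = 0 := by
  induction P using Polynomial.induction_on' with
  | add P Q hP hQ => rw [polyAtInfty_add, HahnSeries.coeff_add, hP, hQ, add_zero]
  | monomial i c =>
    rw [← C_mul_X_pow_eq_monomial, polyAtInfty_monomial, HahnSeries.coeff_single_of_ne (by omega)]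

theorem coeff_laurentAtInfty_of_nonpos (s : ℕ → ℂ) {k : ℤ} (hk : k ≤ 0) :
    (laurentAtInfty s).coeff k = 0 := by
  rw [laurentAtInfty, PowerSeries.coeff_coe]
  split_ifs with h
  · rfl
  · obtain rfl : k = 0 := by omega
    simp

theorem coeff_laurentAtInfty_succ (s : ℕ → ℂ) (k : ℕ) :
    (laurentAtInfty s).coeff ((k : ℤ) + 1) = s k := by
  rw [laurentAtInfty, ← Nat.cast_succ, HahnSeries.ofPowerSeries_apply_coeff,
    PowerSeries.coeff_succ_X_mul, PowerSeries.coeff_mk]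

/-- The leading coefficient of the remainder is a moment. -/
theorem remainderCoeff_eq_moment (s : ℕ → ℂ) (P : ℂ[X]) (k : ℕ) :
    remainderCoeff s P k = moment s (X ^ k * P) := by
  unfold remainderCoeff
  induction P using Polynomial.induction_on' with
  | add P Q hP hQ =>
    rw [polyAtInfty_add, mul_add, HahnSeries.coeff_add, hP, hQ, mul_add, map_add]
  | monomial i c =>
    rw [← C_mul_X_pow_eq_monomial, polyAtInfty_monomial, HahnSeries.coeff_mul_single,
      show (k : ℤ) + 1 - -(i : ℤ) = ((k + i : ℕ) : ℤ) + 1 by push_cast; ring,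
      coeff_laurentAtInfty_succ, mul_left_comm, moment_C_mul, ← pow_add, moment_X_pow, mul_comm]

/-- The product of a polynomial and a series at infinity has a polynomial part. -/
theorem exists_polynomial_part (s : ℕ → ℂ) (P : ℂ[X]) :
    ∃ Q : ℂ[X], ∀ k : ℤ, k ≤ 0 →
      (laurentAtInfty s * polyAtInfty P - polyAtInfty Q).coeff k = 0 := by
  have hX : polyAtInfty X = HahnSeries.single (-1 : ℤ) (1 : ℂ) := aeval_X _
  have hmul : ∀ P Q : ℂ[X], polyAtInfty (P * Q) = polyAtInfty P * polyAtInfty Q :=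
    fun P Q => map_mul _ P Q
  induction P using Polynomial.induction_on with
  | C c =>
    refine ⟨0, fun k hk => ?_⟩
    have h := polyAtInfty_monomial 0 c
    rw [pow_zero, mul_one, Nat.cast_zero, neg_zero] at h
    rw [h, HahnSeries.coeff_sub, HahnSeries.coeff_mul_single_zero,
      coeff_laurentAtInfty_of_nonpos s hk, polyAtInfty, map_zero]
    simp
  | add P P' hP hP' =>
    obtain ⟨Q, hQ⟩ := hP
    obtain ⟨Q', hQ'⟩ := hP'
    refine ⟨Q + Q', fun k hk => ?_⟩
    rw [polyAtInfty_add, polyAtInfty_add, mul_add, add_sub_add_comm, HahnSeries.coeff_add,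
      hQ k hk, hQ' k hk, add_zero]
  | monomial i c ih =>
    obtain ⟨Q, hQ⟩ := ih
    set g := laurentAtInfty s * polyAtInfty (C c * X ^ i) - polyAtInfty Q with hg
    -- Multiplication by z moves the z⁻¹ coefficient of the remainder to z⁰, so it has to join the
    -- polynomial part.
    refine ⟨Q * X + C (g.coeff 1), fun k hk => ?_⟩
    have hC := polyAtInfty_monomial 0 (g.coeff 1)
    rw [pow_zero, mul_one, Nat.cast_zero, neg_zero] at hC
    rw [pow_succ, ← mul_assoc, hmul _ X, polyAtInfty_add, hmul Q X, hC, ← sub_sub, ← mul_assoc, ← sub_mul,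
      ← hg, HahnSeries.coeff_sub, hX, HahnSeries.coeff_mul_single, mul_one, sub_neg_eq_add]
    rcases hk.lt_or_eq with hk | rfl
    · rw [hQ _ (by omega), HahnSeries.coeff_single_of_ne hk.ne, sub_zero]
    · rw [HahnSeries.coeff_single_same, zero_add, sub_self]

/-- A polynomial can cancel all nonnegative powers of z and touches no negative one, so only the
coefficients of z⁻¹, …, z⁻ⁿ of the product impose conditions, and these are moments. -/
theorem exists_isBigOInfty_iff (s : ℕ → ℂ) (P : ℂ[X]) (n : ℕ) :
    (∃ Q : ℂ[X], IsBigOInfty (laurentAtInfty s * polyAtInfty P - polyAtInfty Q) (n + 1)) ↔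
      ∀ k < n, moment s (X ^ k * P) = 0 := by
  constructor
  · rintro ⟨Q, hQ⟩ k hk
    have h := hQ ((k : ℤ) + 1) (by push_cast; omega)
    rw [HahnSeries.coeff_sub, coeff_polyAtInfty_of_pos Q (by omega), sub_zero] at h
    rw [← remainderCoeff_eq_moment]
    exact h
  · intro h
    obtain ⟨Q, hQ⟩ := exists_polynomial_part s P
    refine ⟨Q, fun k hk => ?_⟩
    rcases le_or_gt k 0 with hk0 | hk0
    · exact hQ k hk0
    · obtain ⟨j, rfl⟩ : ∃ j : ℕ, k = (j : ℤ) + 1 := ⟨(k - 1).toNat, by omega⟩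
      rw [HahnSeries.coeff_sub, coeff_polyAtInfty_of_pos Q hk0, sub_zero]
      have := h j (by push_cast at hk; omega)
      rwa [← remainderCoeff_eq_moment] at this

/-- Solutions of the Hermite-Padé problem are the multiple orthogonal polynomials. -/
theorem isSolution_iff (s : Fin 2 → ℕ → ℂ) (n m : ℕ) (P : ℂ[X]) :
    IsSolution s n m P ↔ P.natDegree ≤ n + m ∧
      (∀ k < n, moment (s 0) (X ^ k * P) = 0) ∧ (∀ k < m, moment (s 1) (X ^ k * P) = 0) := by
  rw [IsSolution, exists_isBigOInfty_iff, exists_isBigOInfty_iff]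

theorem IsSolution.sub {s : Fin 2 → ℕ → ℂ} {n m : ℕ} {P Q : ℂ[X]} (hP : IsSolution s n m P)
    (hQ : IsSolution s n m Q) : IsSolution s n m (P - Q) := by
  rw [isSolution_iff] at *
  refine ⟨(natDegree_sub_le _ _).trans (max_le hP.1 hQ.1), fun k hk => ?_, fun k hk => ?_⟩
  · rw [mul_sub, map_sub, hP.2.1 k hk, hQ.2.1 k hk, sub_zero]
  · rw [mul_sub, map_sub, hP.2.2 k hk, hQ.2.2 k hk, sub_zero]

theorem IsSolution.C_mul {s : Fin 2 → ℕ → ℂ} {n m : ℕ} {P : ℂ[X]} (hP : IsSolution s n m P)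
    (r : ℂ) : IsSolution s n m (C r * P) := by
  rw [isSolution_iff] at *
  refine ⟨(natDegree_C_mul_le _ _).trans hP.1, fun k hk => ?_, fun k hk => ?_⟩
  · rw [mul_left_comm, moment_C_mul, hP.2.1 k hk, mul_zero]
  · rw [mul_left_comm, moment_C_mul, hP.2.2 k hk, mul_zero]

/-! ### Hermite-Padé tables -/

section Table

variable {s : Fin 2 → ℕ → ℂ} {P : ℕ → ℕ → ℂ[X]}

theorem IsHermitePadeTable.moment_zero (hP : IsHermitePadeTable s P) {n m k : ℕ} (hk : k < n) :
    moment (s 0) (X ^ k * P n m) = 0 :=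
  ((isSolution_iff s n m _).1 (hP n m).2).2.1 k hk

theorem IsHermitePadeTable.moment_one (hP : IsHermitePadeTable s P) {n m k : ℕ} (hk : k < m) :
    moment (s 1) (X ^ k * P n m) = 0 :=
  ((isSolution_iff s n m _).1 (hP n m).2).2.2 k hk

theorem IsPerfect.natDegree_eq (hs : IsPerfect s) (hP : IsHermitePadeTable s P) (n m : ℕ) :
    (P n m).natDegree = n + m :=
  (hs n m).2 _ (hP n m).2 (hP n m).1.ne_zero

/-- Otherwise `P n m` would also solve the problem for (n+1, m), with degree one too small for a
normal index. -/
theorem IsPerfect.moment_zero_ne (hs : IsPerfect s) (hP : IsHermitePadeTable s P) (n m : ℕ) :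
    moment (s 0) (X ^ n * P n m) ≠ 0 := by
  intro h
  have hdeg := hs.natDegree_eq hP n m
  have hsol : IsSolution s (n + 1) m (P n m) := by
    rw [isSolution_iff]
    refine ⟨by omega, fun k hk => ?_, fun k hk => hP.moment_one hk⟩
    rcases Nat.lt_succ_iff_lt_or_eq.1 hk with hk | rfl
    · exact hP.moment_zero hk
    · exact h
  have := (hs (n + 1) m).2 _ hsol (hP n m).1.ne_zero
  omega

theorem IsPerfect.moment_one_ne (hs : IsPerfect s) (hP : IsHermitePadeTable s P) (n m : ℕ) :
    moment (s 1) (X ^ m * P n m) ≠ 0 := by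
  intro h
  have hdeg := hs.natDegree_eq hP n m
  have hsol : IsSolution s n (m + 1) (P n m) := by
    rw [isSolution_iff]
    refine ⟨by omega, fun k hk => hP.moment_zero hk, fun k hk => ?_⟩
    rcases Nat.lt_succ_iff_lt_or_eq.1 hk with hk | rfl
    · exact hP.moment_one hk
    · exact h
  have := (hs n (m + 1)).2 _ hsol (hP n m).1.ne_zero
  omega

/-- A table of monic multiple orthogonal polynomials with nonvanishing leading remainders belongs
to a perfect system. -/
theorem IsHermitePadeTable.isPerfect (hP : IsHermitePadeTable s P)
    (hdeg : ∀ n m, (P n m).natDegree = n + m)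
    (h0 : ∀ n m, moment (s 0) (X ^ n * P n m) ≠ 0)
    (h1 : ∀ n m, moment (s 1) (X ^ m * P n m) ≠ 0) : IsPerfect s := by
  -- Induction on n + m: after removal of its top coefficient a solution solves the problem for a
  -- smaller index, so it is a multiple of that polynomial. The one condition dropped in passing to
  -- that index pairs with a nonzero moment and forces the multiple to be zero.
  have key : ∀ N n m, n + m = N → ∀ R : ℂ[X], IsSolution s n m R → ∃ r : ℂ, R = C r * P n m := by
    intro N
    induction N with
    | zero =>
      intro n m hnm R hR
      obtain ⟨rfl, rfl⟩ : n = 0 ∧ m = 0 := by omega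
      have hR0 : R.natDegree = 0 := by have := hR.1; omega
      have hP0 : P 0 0 = 1 := eq_one_of_monic_natDegree_zero (hP 0 0).1 (hdeg 0 0)
      exact ⟨R.coeff 0, by rw [hP0, mul_one]; exact eq_C_of_natDegree_eq_zero hR0⟩
    | succ N ih =>
      intro n m hnm R hR
      have hS := hR.sub ((hP n m).2.C_mul (R.coeff (n + m)))
      set S := R - C (R.coeff (n + m)) * P n m with hSdef
      refine ⟨R.coeff (n + m), sub_eq_zero.1 ?_⟩
      rw [← hSdef]
      have hco : S.coeff (n + m) = 0 := by
        have : (P n m).coeff (n + m) = 1 := by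
          rw [← hdeg n m]; exact (hP n m).1
        rw [hSdef, coeff_sub, coeff_C_mul, this, mul_one, sub_self]
      have hS' := (isSolution_iff s n m S).1 hS
      have hdS : S.natDegree ≤ N := by
        refine natDegree_le_iff_coeff_eq_zero.2 fun k hk => ?_
        rcases (Nat.succ_le_of_lt hk).eq_or_lt with h | h
        · rw [← h, Nat.succ_eq_add_one, ← hnm, hco]
        · exact coeff_eq_zero_of_natDegree_lt (by omega)
      rcases n with _ | n
      · obtain ⟨m, rfl⟩ : ∃ j, m = j + 1 := ⟨m - 1, by omega⟩
        obtain ⟨r, hr⟩ := ih 0 m (by omega) S ((isSolution_iff _ _ _ _).2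
          ⟨by omega, fun k hk => by omega, fun k hk => hS'.2.2 k (by omega)⟩)
        have h := hS'.2.2 m (by omega)
        rw [hr, mul_left_comm, moment_C_mul] at h
        rw [hr, (mul_eq_zero.1 h).resolve_right (h1 0 m), C_0, zero_mul]
      · obtain ⟨r, hr⟩ := ih n m (by omega) S ((isSolution_iff _ _ _ _).2
          ⟨by omega, fun k hk => hS'.2.1 k (by omega), fun k hk => hS'.2.2 k (by omega)⟩)
        have h := hS'.2.1 n (by omega)
        rw [hr, mul_left_comm, moment_C_mul] at h
        rw [hr, (mul_eq_zero.1 h).resolve_right (h0 n m), C_0, zero_mul]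
  refine fun n m => ⟨fun R R' hR hR' hR0 => ?_, fun R hR hR0 => ?_⟩
  · obtain ⟨r, hr⟩ := key _ n m rfl R hR
    obtain ⟨r', hr'⟩ := key _ n m rfl R' hR'
    have hr0 : r ≠ 0 := by
      rintro rfl
      exact hR0 (by rw [hr, C_0, zero_mul])
    refine ⟨r' / r, ?_⟩
    rw [hr, hr', ← mul_assoc, ← C_mul, div_mul_cancel₀ _ hr0]
  · obtain ⟨r, hr⟩ := key _ n m rfl R hR
    have hr0 : r ≠ 0 := by
      rintro rfl
      exact hR0 (by rw [hr, C_0, zero_mul])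
    rw [hr, natDegree_C_mul hr0, hdeg]

/-- The Hermite-Padé problem has nontrivial solutions. -/
theorem exists_isSolution_ne_zero (s : Fin 2 → ℕ → ℂ) (n m : ℕ) :
    ∃ R : ℂ[X], R ≠ 0 ∧ IsSolution s n m R := by
  let F : degreeLT ℂ (n + m + 1) →ₗ[ℂ] (Fin n ⊕ Fin m → ℂ) :=
    LinearMap.pi (Sum.elim
      (fun k => (moment (s 0) ∘ₗ LinearMap.mulLeft ℂ (X ^ (k : ℕ))) ∘ₗ (degreeLT ℂ _).subtype)
      (fun k => (moment (s 1) ∘ₗ LinearMap.mulLeft ℂ (X ^ (k : ℕ))) ∘ₗ (degreeLT ℂ _).subtype))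
  have hF : LinearMap.ker F ≠ ⊥ := by
    have : Module.Finite ℂ (degreeLT ℂ (n + m + 1)) :=
      Module.Finite.equiv (degreeLTEquiv ℂ (n + m + 1)).symm
    -- There are n + m + 1 unknown coefficients and n + m linear conditions.
    refine F.ker_ne_bot_of_finrank_lt ?_
    rw [(degreeLTEquiv ℂ (n + m + 1)).finrank_eq]
    simp
  obtain ⟨⟨R, hR⟩, hRF, hR0⟩ := (Submodule.ne_bot_iff _).1 hF
  have hR0' : R ≠ 0 := fun h => hR0 (Subtype.ext h)
  refine ⟨R, hR0', (isSolution_iff _ _ _ _).2 ⟨?_, fun k hk => ?_, fun k hk => ?_⟩⟩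
  · have := (natDegree_lt_iff_degree_lt hR0').2 (mem_degreeLT.1 hR)
    omega
  · exact congrFun (LinearMap.mem_ker.1 hRF) (Sum.inl ⟨k, hk⟩)
  · exact congrFun (LinearMap.mem_ker.1 hRF) (Sum.inr ⟨k, hk⟩)

theorem exists_isHermitePadeTable (s : Fin 2 → ℕ → ℂ) :
    ∃ P : ℕ → ℕ → ℂ[X], IsHermitePadeTable s P := by
  have h : ∀ n m, ∃ R : ℂ[X], R.Monic ∧ IsSolution s n m R := by
    intro n m
    obtain ⟨R, hR0, hR⟩ := exists_isSolution_ne_zero s n m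
    refine ⟨C R.leadingCoeff⁻¹ * R, ?_, hR.C_mul _⟩
    rw [mul_comm]
    exact monic_mul_leadingCoeff_inv hR0
  choose P hP using h
  exact ⟨P, hP⟩

end Table

/-! ### Recurrence relations and zero curvature -/

namespace Entries

variable (T : Entries)

theorem det_L (n m : ℕ) : (T.L n m).det = C (-(T.α₄ (n + 1) m * T.α₂ n m)) := by
  simp [L, Matrix.det_fin_three]
  ring

theorem det_M (n m : ℕ) : (T.M n m).det = C (-(T.α₅ n (m + 1) * T.α₃ n m)) := by
  simp [M, Matrix.det_fin_three]
  ring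

theorem isUnit_L_iff (n m : ℕ) : IsUnit (T.L n m) ↔ T.α₄ (n + 1) m ≠ 0 ∧ T.α₂ n m ≠ 0 := by
  rw [Matrix.isUnit_iff_isUnit_det, det_L, isUnit_C, isUnit_iff_ne_zero, neg_ne_zero, mul_ne_zero_iff]

theorem isUnit_M_iff (n m : ℕ) : IsUnit (T.M n m) ↔ T.α₅ n (m + 1) ≠ 0 ∧ T.α₃ n m ≠ 0 := by
  rw [Matrix.isUnit_iff_isUnit_det, det_M, isUnit_C, isUnit_iff_ne_zero, neg_ne_zero, mul_ne_zero_iff]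

variable {T}

theorem Admissible.α₂_ne (hT : T.Admissible) (n m : ℕ) : T.α₂ n m ≠ 0 :=
  ((T.isUnit_L_iff n m).1 (hT.1 n m)).2

theorem Admissible.α₃_ne (hT : T.Admissible) (n m : ℕ) : T.α₃ n m ≠ 0 :=
  ((T.isUnit_M_iff n m).1 (hT.2.1 n m)).2

theorem Admissible.α₄_ne (hT : T.Admissible) (n m : ℕ) : T.α₄ (n + 1) m ≠ 0 :=
  ((T.isUnit_L_iff n m).1 (hT.1 n m)).1

theorem Admissible.α₅_ne (hT : T.Admissible) (n m : ℕ) : T.α₅ n (m + 1) ≠ 0 :=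
  ((T.isUnit_M_iff n m).1 (hT.2.1 n m)).1

theorem Admissible.α₄_zero (hT : T.Admissible) (m : ℕ) : T.α₄ 0 m = 0 := by
  have h := hT.2.2.1 m
  rw [a, neg_eq_zero] at h
  exact (mul_eq_zero.1 h).resolve_right (hT.α₂_ne 0 m)

theorem Admissible.α₅_zero (hT : T.Admissible) (n : ℕ) : T.α₅ n 0 = 0 := by
  have h := hT.2.2.2 n
  rw [b, neg_eq_zero] at h
  exact (mul_eq_zero.1 h).resolve_right (hT.α₃_ne n 0)

variable (T)

/-- The zero curvature condition at a point of the lattice, written out in the entries. -/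
structure IsFlatAt (n m : ℕ) : Prop where
  trace : T.α₁ n (m + 1) + T.β₁ n m = T.β₁ (n + 1) m + T.α₁ n m
  norm : T.α₁ n (m + 1) * T.β₁ n m - T.a n (m + 1) - T.b n (m + 1)
    = T.β₁ (n + 1) m * T.α₁ n m - T.a (n + 1) m - T.b (n + 1) m
  eq_α₂ : T.α₁ n (m + 1) * T.α₂ n m + T.α₂ n (m + 1) = T.β₁ (n + 1) m * T.α₂ n m
  eq_α₃ : T.α₁ n (m + 1) * T.α₃ n m = T.β₁ (n + 1) m * T.α₃ n m + T.α₃ (n + 1) m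
  eq_α₄ : T.α₄ (n + 1) (m + 1) * T.β₁ n m = T.α₄ (n + 1) (m + 1) * T.α₁ n m + T.α₄ (n + 1) m
  eq_α₅ : T.α₅ (n + 1) (m + 1) * T.β₁ n m + T.α₅ n (m + 1) = T.α₅ (n + 1) (m + 1) * T.α₁ n m

/-- In entry (0,0) the x² terms cancel, leaving an affine polynomial whose slope and constant term
are `trace` and `norm`. In the rest of the first row and column the x terms cancel; the lower right
2×2 blocks agree identically. -/
theorem zeroCurvature_iff : T.ZeroCurvature ↔ ∀ n m, T.IsFlatAt n m := by
  refine forall₂_congr fun n m => ⟨fun h => ?_, fun h => ?_⟩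
  · have ev : ∀ (i j : Fin 3) (x : ℂ), eval x ((T.L n (m + 1) * T.M n m) i j)
        = eval x ((T.M (n + 1) m * T.L n m) i j) := fun i j x => by rw [h]
    have h00 := ev 0 0 0
    have h00' := ev 0 0 1
    have h01 := ev 0 1 0
    have h02 := ev 0 2 0
    have h10 := ev 1 0 0
    have h20 := ev 2 0 0
    simp [L, M, Matrix.mul_apply, Fin.sum_univ_three] at h00 h00' h01 h02 h10 h20
    refine ⟨?_, ?_, ?_, ?_, ?_, ?_⟩
    · linear_combination h00' - h00
    · simp only [a, b]
      linear_combination h00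
    · linear_combination h01
    · linear_combination h02
    · linear_combination h10
    · linear_combination h20
  · ext1 i j
    refine Polynomial.funext fun x => ?_
    obtain ⟨h1, h2, h3, h4, h5, h6⟩ := h
    simp only [a, b] at h2
    fin_cases i <;> fin_cases j <;> simp [L, M, Matrix.mul_apply, Fin.sum_univ_three]
    · linear_combination x * h1 + h2
    · linear_combination h3
    · linear_combination h4
    · linear_combination h5
    · linear_combination h6

end Entries

/-! ### Recurrences of a perfect system and their compatibility -/

section Recurrences

variable {s : Fin 2 → ℕ → ℂ} {P : ℕ → ℕ → ℂ[X]} {a b c d : ℕ → ℕ → ℂ}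

/-- Two neighbours on an antidiagonal differ by a multiple of their common predecessor. -/
theorem SatisfiesRecurrences.antidiagonal (hR : SatisfiesRecurrences a b c d P) (n m : ℕ) :
    P n (m + 1) = P (n + 1) m + C (c n m - d n m) * P n m := by
  obtain ⟨-, -, -, -, hn, hm⟩ := hR
  rw [hn, hm, C_sub]
  ring

theorem SatisfiesRecurrences.X_mul (hR : SatisfiesRecurrences a b c d P) (n m : ℕ) :
    X * P n m = P (n + 1) m + C (c n m) * P n m + C (a n m) * P (n - 1) m
      + C (b n m) * P n (m - 1) := by
  obtain ⟨-, -, -, -, hn, -⟩ := hR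
  rw [hn]
  ring

/-- In the antidiagonal relation the polynomial of index (n+1, m) is orthogonal to X^n. For a
perfect system this also shows c ≠ d. -/
theorem SatisfiesRecurrences.moment_zero_succ_right (hR : SatisfiesRecurrences a b c d P)
    (hP : IsHermitePadeTable s P) (n m : ℕ) :
    moment (s 0) (X ^ n * P n (m + 1)) = (c n m - d n m) * moment (s 0) (X ^ n * P n m) := by
  rw [hR.antidiagonal, mul_add, map_add, hP.moment_zero n.lt_succ_self, zero_add, mul_left_comm,
    moment_C_mul]

theorem SatisfiesRecurrences.moment_one_succ_left (hR : SatisfiesRecurrences a b c d P)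
    (hP : IsHermitePadeTable s P) (n m : ℕ) :
    moment (s 1) (X ^ m * P (n + 1) m) = (d n m - c n m) * moment (s 1) (X ^ m * P n m) := by
  rw [eq_sub_of_add_eq (hR.antidiagonal n m).symm, mul_sub, map_sub,
    hP.moment_one m.lt_succ_self, zero_sub, mul_left_comm, moment_C_mul]
  ring

/-- Move one factor `X` onto the polynomial: of the four terms of the recurrence, only the one with
first index n is not orthogonal to X^n. -/
theorem SatisfiesRecurrences.moment_zero_succ_left (hR : SatisfiesRecurrences a b c d P)
    (hP : IsHermitePadeTable s P) (n m : ℕ) :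
    moment (s 0) (X ^ (n + 1) * P (n + 1) m) = a (n + 1) m * moment (s 0) (X ^ n * P n m) := by
  rw [pow_succ, mul_assoc, hR.X_mul]
  simp only [mul_add, map_add, mul_left_comm _ (C _), moment_C_mul]
  rw [hP.moment_zero (by omega), hP.moment_zero (by omega), hP.moment_zero (m := m - 1) (by omega)]
  simp

theorem SatisfiesRecurrences.moment_one_succ_right (hR : SatisfiesRecurrences a b c d P)
    (hP : IsHermitePadeTable s P) (n m : ℕ) :
    moment (s 1) (X ^ (m + 1) * P n (m + 1)) = b n (m + 1) * moment (s 1) (X ^ m * P n m) := by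
  rw [pow_succ, mul_assoc, hR.X_mul]
  simp only [mul_add, map_add, mul_left_comm _ (C _), moment_C_mul]
  rw [hP.moment_one (by omega), hP.moment_one (by omega), hP.moment_one (n := n - 1) (by omega)]
  simp

/-- Compatibility of the two ways from `(n, m)` to `(n + 1, m + 1)`. -/
theorem SatisfiesRecurrences.compatible (hR : SatisfiesRecurrences a b c d P)
    (hmonic : ∀ n m, (P n m).Monic) (hdeg : ∀ n m, (P n m).natDegree = n + m) (n m : ℕ) :
    c n (m + 1) + d n m = d (n + 1) m + c n m ∧
      c n (m + 1) * d n m - a n (m + 1) - b n (m + 1)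
        = d (n + 1) m * c n m - a (n + 1) m - b (n + 1) m := by
  have hn := hR.2.2.2.2.1
  have hm := hR.2.2.2.2.2
  have hA : C (a n (m + 1)) * P (n - 1) (m + 1) = C (a n (m + 1)) * (P n m
      + C (c (n - 1) m - d (n - 1) m) * P (n - 1) m) := by
    rcases n with _ | n
    · rw [hR.1, C_0, zero_mul, zero_mul]
    · rw [Nat.add_sub_cancel, hR.antidiagonal]
  have hB : C (b (n + 1) m) * P (n + 1) (m - 1) = C (b (n + 1) m) * (P n m
      - C (c n (m - 1) - d n (m - 1)) * P n (m - 1)) := by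
    rcases m with _ | m
    · rw [hR.2.1, C_0, zero_mul, zero_mul]
    · rw [Nat.add_sub_cancel, hR.antidiagonal, add_sub_cancel_right]
  have h1 := hn n (m + 1)
  have h2 := hm (n + 1) m
  rw [Nat.add_sub_cancel, hA, hm n m] at h1
  rw [Nat.add_sub_cancel, hB, hn n m] at h2
  set u : ℂ := d (n + 1) m + c n m - (c n (m + 1) + d n m) with hu
  set v : ℂ := c n (m + 1) * d n m - a n (m + 1) - b n (m + 1)
    - (d (n + 1) m * c n m - a (n + 1) m - b (n + 1) m) with hv
  set v₁ : ℂ := (c n (m + 1) - d (n + 1) m) * a n m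
    - a n (m + 1) * (c (n - 1) m - d (n - 1) m) with hv₁
  set v₂ : ℂ := (c n (m + 1) - d (n + 1) m) * b n m
    - b (n + 1) m * (c n (m - 1) - d n (m - 1)) with hv₂
  have a_zero : ∀ m, a 0 m = 0 := hR.1
  have b_zero : ∀ n, b n 0 = 0 := hR.2.1
  -- The difference of the two expansions of `P (n + 1) (m + 1)`. The last two terms have no
  -- coefficient in degree n + m or above, so degrees n + m + 1 and n + m isolate `u` and `v`.
  have key : C u * (X * P n m) + C v * P n m + (C v₁ * P (n - 1) m + C v₂ * P n (m - 1)) = 0 := by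
    have h := h1.symm.trans h2
    simp only [hu, hv, hv₁, hv₂, C_sub, C_add, C_mul] at h ⊢
    linear_combination h
  have low : ∀ k, n + m ≤ k → (C v₁ * P (n - 1) m + C v₂ * P n (m - 1)).coeff k = 0 := by
    intro k hk
    have h₁ : v₁ * (P (n - 1) m).coeff k = 0 := by
      -- At n = 0 the truncated index gives `P 0 m`, which has full degree; here the vanishing of `a
      -- 0 _` is what kills the term.
      rcases n with _ | n
      · simp [hv₁, a_zero]
      · rw [coeff_eq_zero_of_natDegree_lt (by rw [hdeg]; omega), mul_zero]
    have h₂ : v₂ * (P n (m - 1)).coeff k = 0 := by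
      rcases m with _ | m
      · simp [hv₂, b_zero]
      · rw [coeff_eq_zero_of_natDegree_lt (by rw [hdeg]; omega), mul_zero]
    rw [coeff_add, coeff_C_mul, coeff_C_mul, h₁, h₂, add_zero]
  have hlead : (P n m).coeff (n + m) = 1 := by
    rw [← hdeg n m]
    exact hmonic n m
  have hu0 : u = 0 := by
    have h := congrArg (fun p => coeff p (n + m + 1)) key
    rw [coeff_add, low _ (Nat.le_succ _), coeff_add, coeff_C_mul, coeff_C_mul, coeff_X_mul, hlead,
      coeff_eq_zero_of_natDegree_lt ((hdeg n m).trans_lt (Nat.lt_succ_self _))] at h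
    simpa using h
  have hv0 : v = 0 := by
    have h := congrArg (fun p => coeff p (n + m)) key
    rw [hu0] at h
    simp only [C_0, zero_mul, zero_add] at h
    rw [coeff_add, coeff_C_mul, hlead, low _ le_rfl] at h
    simpa using h
  constructor
  · linear_combination -hu0
  · linear_combination hv0

/-- The entries corresponding to a perfect system satisfy the zero curvature condition. -/
theorem IsPerfect.zeroCurvature {T : Entries} (hs : IsPerfect s) (hT : Corresponds T s) :
    T.ZeroCurvature := by
  obtain ⟨P, hP, hR, p, q, hp, hq, -, -, h2, h3, h4, h5⟩ := hT
  simp only [remainderCoeff_eq_moment] at h2 h3 h4 h5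
  rw [T.zeroCurvature_iff]
  intro n m
  obtain ⟨e1, e2⟩ := hR.compatible (fun n m => (hP n m).1) (hs.natDegree_eq hP) n m
  have r0 := hR.moment_zero_succ_right hP n m
  have r1 := hR.moment_one_succ_left hP n m
  have g0 := hs.moment_zero_ne hP n m
  have g1 := hs.moment_one_ne hP n m
  -- The next moment is nonzero, so its factor c - d is nonzero too; this permits the divisions in
  -- the relations for `α₄` and `α₅`.
  have k0 := r0 ▸ hs.moment_zero_ne hP n (m + 1)
  have k1 := r1 ▸ hs.moment_one_ne hP (n + 1) m
  simp only [Entries.c, Entries.d] at e1 e2 r0 r1 k0 k1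
  have δ0 := left_ne_zero_of_mul k0
  have δ1 := left_ne_zero_of_mul k1
  have hpn := hp n
  have hqm := hq m
  refine ⟨?_, ?_, ?_, ?_, ?_, ?_⟩
  · linear_combination -e1
  · linear_combination e2
  · rw [h2, h2, r0]
    linear_combination (-e1) * moment (s 0) (X ^ n * P n m) / p n
  · rw [h3, h3, r1]
    linear_combination (-e1) * moment (s 1) (X ^ m * P n m) / q m
  · rw [h4, h4, r0]
    field_simp
    ring
  · rw [h5, h5, r1]
    field_simp
    ring

/-- The recurrence coefficients of a perfect system are the coefficients of an admissible family
corresponding to it. -/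
theorem IsPerfect.exists_entries (hs : IsPerfect s) (hP : IsHermitePadeTable s P)
    (hR : SatisfiesRecurrences a b c d P) :
    ∃ T : Entries, T.Admissible ∧ T.a = a ∧ T.b = b ∧ T.c = c ∧ T.d = d ∧ Corresponds T s := by
  have h0 := hs.moment_zero_ne hP
  have h1 := hs.moment_one_ne hP
  -- The normalisation p = q = 1. The free boundary values of `α₄` and `α₅` are set to 0 to give `a
  -- 0 m = 0` and `b n 0 = 0`.
  let T : Entries :=
    { α₁ := fun n m => -c n m
      β₁ := fun n m => -d n m
      α₂ := fun n m => moment (s 0) (X ^ n * P n m)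
      α₃ := fun n m => moment (s 1) (X ^ m * P n m)
      α₄ := fun n m => n.casesOn 0 fun n => -(1 / moment (s 0) (X ^ n * P n m))
      α₅ := fun n m => m.casesOn 0 fun m => -(1 / moment (s 1) (X ^ m * P n m)) }
  have ha : T.a = a := by
    ext n m
    rcases n with _ | n
    · simp [T, Entries.a, hR.1]
    · have := h0 n m
      simp only [T, Entries.a, hR.moment_zero_succ_left hP]
      field_simp
  have hb : T.b = b := by
    ext n m
    rcases m with _ | m
    · simp [T, Entries.b, hR.2.1]
    · have := h1 n m
      simp only [T, Entries.b, hR.moment_one_succ_right hP]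
      field_simp
  have hc : T.c = c := by
    ext n m
    simp [T, Entries.c]
  have hd : T.d = d := by
    ext n m
    simp [T, Entries.d]
  refine ⟨T, ⟨fun n m => ?_, fun n m => ?_, ?_, ?_⟩, ha, hb, hc, hd, P, hP, ?_, fun _ => 1,
    fun _ => 1, ?_⟩
  · rw [T.isUnit_L_iff]
    exact ⟨neg_ne_zero.2 (one_div_ne_zero (h0 n m)), h0 n m⟩
  · rw [T.isUnit_M_iff]
    exact ⟨neg_ne_zero.2 (one_div_ne_zero (h1 n m)), h1 n m⟩
  · rw [ha]
    exact hR.1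
  · rw [hb]
    exact hR.2.1
  · rw [ha, hb, hc, hd]
    exact hR
  · simp only [remainderCoeff_eq_moment]
    simp [T, h0, h1]

/-- The Hermite-Padé polynomials of a perfect system satisfy the nearest neighbour recurrence
relations. -/
theorem IsPerfect.exists_recurrences (hs : IsPerfect s) (hP : IsHermitePadeTable s P) :
    ∃ a b c d : ℕ → ℕ → ℂ, SatisfiesRecurrences a b c d P := by
  have h0 := hs.moment_zero_ne hP
  have h1 := hs.moment_one_ne hP
  have hdeg := hs.natDegree_eq hP
  let a : ℕ → ℕ → ℂ := fun n m => n.casesOn 0 fun n =>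
    moment (s 0) (X ^ (n + 1) * P (n + 1) m) / moment (s 0) (X ^ n * P n m)
  let b : ℕ → ℕ → ℂ := fun n m => m.casesOn 0 fun m =>
    moment (s 1) (X ^ (m + 1) * P n (m + 1)) / moment (s 1) (X ^ m * P n m)
  have ha : ∀ m, a 0 m = 0 := fun m => rfl
  have hb : ∀ n, b n 0 = 0 := fun n => rfl
  have key : ∀ n m (Q : ℂ[X]), Q.Monic → Q.natDegree = n + m + 1 →
      (∀ k < n, moment (s 0) (X ^ k * Q) = 0) → (∀ k < m, moment (s 1) (X ^ k * Q) = 0) →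
      ∃ r : ℂ, Q = (X - C r) * P n m - C (a n m) * P (n - 1) m - C (b n m) * P n (m - 1) := by
    intro n m Q hQ hQdeg hQ0 hQ1
    have hsol : IsSolution s n m
        (X * P n m - Q - C (a n m) * P (n - 1) m - C (b n m) * P n (m - 1)) := by
      rw [isSolution_iff]
      refine ⟨?_, fun k hk => ?_, fun k hk => ?_⟩
      · have d1 : (X * P n m - Q).natDegree ≤ n + m := by
          have hX : (X * P n m).natDegree = n + m + 1 := by
            rw [natDegree_X_mul (hP n m).1.ne_zero, hdeg]
          refine natDegree_le_iff_coeff_eq_zero.2 fun k hk => ?_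
          rcases (Nat.succ_le_of_lt hk).eq_or_lt with h | h
          · have hX1 : (X * P n m).coeff k = 1 := by
              rw [← h, Nat.succ_eq_add_one, ← hX]
              exact monic_X.mul (hP n m).1
            have hQ1 : Q.coeff k = 1 := by
              rw [← h, Nat.succ_eq_add_one, ← hQdeg]
              exact hQ
            rw [coeff_sub, hX1, hQ1, sub_self]
          · rw [coeff_sub, coeff_eq_zero_of_natDegree_lt (by omega),
              coeff_eq_zero_of_natDegree_lt (by omega), sub_zero]
        have d2 : (C (a n m) * P (n - 1) m).natDegree ≤ n + m :=
          (natDegree_C_mul_le _ _).trans (by rw [hdeg]; omega)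
        have d3 : (C (b n m) * P n (m - 1)).natDegree ≤ n + m :=
          (natDegree_C_mul_le _ _).trans (by rw [hdeg]; omega)
        simpa using natDegree_sub_le_of_le (natDegree_sub_le_of_le d1 d2) d3
      · simp only [mul_sub, map_sub, mul_left_comm _ (C _), moment_C_mul]
        rw [hQ0 k hk, hP.moment_zero (m := m - 1) hk, ← mul_assoc, ← pow_succ]
        obtain ⟨n, rfl⟩ : ∃ j, n = j + 1 := ⟨n - 1, by omega⟩
        rw [Nat.add_sub_cancel]
        -- Only the top power fails to be orthogonal automatically; the quotient defining `a` is
        -- chosen to cancel it.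
        rcases Nat.lt_succ_iff_lt_or_eq.1 hk with hk' | rfl
        · rw [hP.moment_zero (by omega), hP.moment_zero hk']
          ring
        · have := h0 k m
          simp only [a]
          field_simp
          ring
      · simp only [mul_sub, map_sub, mul_left_comm _ (C _), moment_C_mul]
        rw [hQ1 k hk, hP.moment_one (n := n - 1) hk, ← mul_assoc, ← pow_succ]
        obtain ⟨m, rfl⟩ : ∃ j, m = j + 1 := ⟨m - 1, by omega⟩
        rw [Nat.add_sub_cancel]
        rcases Nat.lt_succ_iff_lt_or_eq.1 hk with hk' | rfl
        · rw [hP.moment_one (by omega), hP.moment_one hk']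
          ring
        · have := h1 n k
          simp only [b]
          field_simp
          ring
    obtain ⟨r, hr⟩ := (hs n m).1 _ _ (hP n m).2 hsol (hP n m).1.ne_zero
    exact ⟨r, by linear_combination -hr⟩
  have hc : ∀ n m, ∃ r : ℂ, P (n + 1) m
      = (X - C r) * P n m - C (a n m) * P (n - 1) m - C (b n m) * P n (m - 1) := fun n m =>
    key n m _ (hP _ _).1 (by rw [hdeg]; omega) (fun k hk => hP.moment_zero (by omega))
      (fun k hk => hP.moment_one hk)
  have hd : ∀ n m, ∃ r : ℂ, P n (m + 1)
      = (X - C r) * P n m - C (a n m) * P (n - 1) m - C (b n m) * P n (m - 1) := fun n m =>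
    key n m _ (hP _ _).1 (by rw [hdeg]; omega) (fun k hk => hP.moment_zero hk)
      (fun k hk => hP.moment_one (by omega))
  choose c hc using hc
  choose d hd using hd
  refine ⟨a, b, c, d, ha, hb, fun n m hn => ?_, fun n m hm => ?_, hc, hd⟩
  · obtain ⟨n, rfl⟩ := Nat.exists_eq_add_of_le' hn
    exact div_ne_zero (h0 _ _) (h0 _ _)
  · obtain ⟨m, rfl⟩ := Nat.exists_eq_add_of_le' hm
    exact div_ne_zero (h1 _ _) (h1 _ _)

end Recurrences

/-! ### From zero curvature to a perfect system -/

namespace Entries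

variable (T : Entries)

/-- The wave function with initial value `(1, 0, 0)`. -/
def wave : ℕ → ℕ → Fin 3 → ℂ[X]
  | 0, 0 => ![1, 0, 0]
  | 0, m + 1 => (T.M 0 m).mulVec (wave 0 m)
  | n + 1, m => (T.L n m).mulVec (wave n m)

variable {T}

theorem wave_succ_left (n m : ℕ) : T.wave (n + 1) m = (T.L n m).mulVec (T.wave n m) := by
  rw [wave]

/-- The definition climbs the column n = 0 and then moves in n; zero curvature carries the upward
step across each later column. -/
theorem ZeroCurvature.wave_succ_right (hT : T.ZeroCurvature) (n m : ℕ) :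
    T.wave n (m + 1) = (T.M n m).mulVec (T.wave n m) := by
  induction n with
  | zero => rw [wave]
  | succ n ih =>
    rw [wave_succ_left, ih, wave_succ_left, Matrix.mulVec_mulVec, Matrix.mulVec_mulVec, hT n m]

/-- For positive n this is the second row of `L`. On the column n = 0 the component starts at 0, and
the second row of `M` preserves that since `α₄` vanishes there. -/
theorem ZeroCurvature.wave_one (hT : T.ZeroCurvature) (hA : T.Admissible) (n m : ℕ) :
    T.wave n m 1 = C (T.α₄ n m) * T.wave (n - 1) m 0 := by
  rcases n with _ | n
  · rw [hA.α₄_zero, C_0, zero_mul]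
    induction m with
    | zero => simp [wave]
    | succ m ih =>
      rw [hT.wave_succ_right]
      simp [M, Matrix.mulVec, dotProduct, Fin.sum_univ_three, ih, hA.α₄_zero]
  · rw [wave_succ_left]
    simp [L, Matrix.mulVec, dotProduct, Fin.sum_univ_three]

theorem ZeroCurvature.wave_two (hT : T.ZeroCurvature) (hA : T.Admissible) (n m : ℕ) :
    T.wave n m 2 = C (T.α₅ n m) * T.wave n (m - 1) 0 := by
  rcases m with _ | m
  · rw [hA.α₅_zero, C_0, zero_mul]
    induction n with
    | zero => simp [wave]
    | succ n ih =>
      rw [wave_succ_left]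
      simp [L, Matrix.mulVec, dotProduct, Fin.sum_univ_three, ih, hA.α₅_zero]
  · rw [hT.wave_succ_right]
    simp [M, Matrix.mulVec, dotProduct, Fin.sum_univ_three]

/-- The first component of the wave function satisfies the recurrence relations. -/
theorem ZeroCurvature.satisfiesRecurrences (hT : T.ZeroCurvature) (hA : T.Admissible) :
    SatisfiesRecurrences T.a T.b T.c T.d fun n m => T.wave n m 0 := by
  refine ⟨hA.2.2.1, hA.2.2.2, fun n m hn => ?_, fun n m hm => ?_, fun n m => ?_, fun n m => ?_⟩
  · obtain ⟨n, rfl⟩ := Nat.exists_eq_add_of_le' hn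
    exact neg_ne_zero.2 (mul_ne_zero (hA.α₄_ne _ _) (hA.α₂_ne _ _))
  · obtain ⟨m, rfl⟩ := Nat.exists_eq_add_of_le' hm
    exact neg_ne_zero.2 (mul_ne_zero (hA.α₅_ne _ _) (hA.α₃_ne _ _))
  · have h1 := hT.wave_one hA n m
    have h2 := hT.wave_two hA n m
    simp only [wave_succ_left]
    simp [L, Matrix.mulVec, dotProduct, Fin.sum_univ_three, h1, h2, a, b, c]
    ring
  · have h1 := hT.wave_one hA n m
    have h2 := hT.wave_two hA n m
    simp only [hT.wave_succ_right]
    simp [M, Matrix.mulVec, dotProduct, Fin.sum_univ_three, h1, h2, a, b, d]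
    ring

end Entries

/-! ### Orthogonality functionals from the recurrences -/

section Favard

variable {P : ℕ → ℕ → ℂ[X]} {a b c d : ℕ → ℕ → ℂ}

/-- The symmetry that yields the second functional from the construction of the first. -/
theorem SatisfiesRecurrences.swap (hR : SatisfiesRecurrences a b c d P) :
    SatisfiesRecurrences (fun n m => b m n) (fun n m => a m n) (fun n m => d m n)
      (fun n m => c m n) fun n m => P m n := by
  obtain ⟨h1, h2, h3, h4, h5, h6⟩ := hR
  refine ⟨h2, h1, fun n m => h4 m n, fun n m => h3 m n, fun n m => ?_, fun n m => ?_⟩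
  · simp only [h6]
    ring
  · simp only [h5]
    ring

theorem SatisfiesRecurrences.monic_and_natDegree (hR : SatisfiesRecurrences a b c d P)
    (h00 : P 0 0 = 1) (n m : ℕ) : (P n m).Monic ∧ (P n m).natDegree = n + m := by
  have step : ∀ {Q A B : ℂ[X]} {N : ℕ} (r : ℂ), Q.Monic → Q.natDegree = N → A.natDegree ≤ N →
      B.natDegree ≤ N → ((X - C r) * Q - A - B).Monic ∧
        ((X - C r) * Q - A - B).natDegree = N + 1 := by
    intro Q A B N r hQ hN hA hB
    have hm : ((X - C r) * Q).Monic := (monic_X_sub_C r).mul hQ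
    have hd : ((X - C r) * Q).natDegree = N + 1 := by
      rw [(monic_X_sub_C r).natDegree_mul hQ, natDegree_X_sub_C, hN, add_comm]
    have hAB : (A + B).natDegree ≤ N := (natDegree_add_le _ _).trans (max_le hA hB)
    rw [sub_sub]
    refine ⟨hm.sub_of_left (degree_lt_degree (by omega)), ?_⟩
    rw [natDegree_sub_eq_left_of_natDegree_lt (by omega), hd]
  induction h : n + m using Nat.strong_induction_on generalizing n m with
  | _ N ih =>
    -- Only a weak degree bound is asked for, so truncated indices such as 0 - 1 = 0 need no
    -- separate case.
    have bound : ∀ (u : ℂ) n' m', n' + m' < N → ∀ K, n' + m' ≤ K →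
        (C u * P n' m').natDegree ≤ K := fun u n' m' hlt K hK =>
      (natDegree_C_mul_le _ _).trans ((ih _ hlt n' m' rfl).2.trans_le hK)
    rcases n with _ | n
    · rcases m with _ | m
      · rw [h00]
        exact ⟨monic_one, by rw [natDegree_one]; omega⟩
      · obtain ⟨i1, i2⟩ := ih (0 + m) (by omega) 0 m rfl
        have := step (d 0 m) i1 i2 (bound (a 0 m) (0 - 1) m (by omega) _ (by omega))
          (bound (b 0 m) 0 (m - 1) (by omega) _ (by omega))
        rw [hR.2.2.2.2.2, ← h]
        exact this
    · obtain ⟨i1, i2⟩ := ih (n + m) (by omega) n m rfl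
      have := step (c n m) i1 i2 (bound (a n m) (n - 1) m (by omega) _ (by omega))
        (bound (b n m) n (m - 1) (by omega) _ (by omega))
      rw [hR.2.2.2.2.1]
      exact ⟨this.1, by rw [this.2]; omega⟩

/-- A Favard type theorem: the recurrence relations produce the first orthogonality functional. -/
theorem SatisfiesRecurrences.exists_moment (hR : SatisfiesRecurrences a b c d P)
    (h00 : P 0 0 = 1) (hcd : ∀ n m, c n m ≠ d n m) :
    ∃ s : ℕ → ℂ, (∀ n m k, k < n → moment s (X ^ k * P n m) = 0) ∧
      ∀ n m, moment s (X ^ n * P n m) ≠ 0 := by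
  have hP := hR.monic_and_natDegree h00
  let S : Polynomial.Sequence ℂ :=
    ⟨fun n => P n 0, fun n => by rw [degree_eq_natDegree (hP n 0).1.ne_zero, (hP n 0).2, add_zero]⟩
  let B := S.basis fun n => by
    have : (S n).leadingCoeff = 1 := (hP n 0).1
    rw [this]
    exact isUnit_one
  obtain ⟨s, hs⟩ : ∃ s : ℕ → ℂ, moment s = B.constr ℂ (fun n => if n = 0 then (1 : ℂ) else 0) :=
    ⟨_, moment_eq_of_X_pow⟩
  have hs0 : ∀ n, moment s (P n 0) = if n = 0 then (1 : ℂ) else 0 := by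
    intro n
    have hB : B n = P n 0 := S.basis_eq_self _ n
    rw [hs, ← hB, B.constr_basis]
  have hanti : ∀ n m (Q : ℂ[X]), moment s (Q * P n (m + 1))
      = moment s (Q * P (n + 1) m) + (c n m - d n m) * moment s (Q * P n m) := by
    intro n m Q
    rw [hR.antidiagonal, mul_add, map_add, mul_left_comm, moment_C_mul]
  -- The antidiagonal relation carries the vanishing from the row m = 0, where it holds by
  -- construction, to all rows.
  have base : ∀ m n, moment s (P (n + 1) m) = 0 := by
    intro m
    induction m with
    | zero => intro n; simp [hs0]
    | succ m ih =>
      intro n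
      have := hanti (n + 1) m 1
      simpa [ih] using this
  have hX : ∀ n m k, moment s (X ^ (k + 1) * P n m) = moment s (X ^ k * P (n + 1) m)
      + c n m * moment s (X ^ k * P n m) + a n m * moment s (X ^ k * P (n - 1) m)
      + b n m * moment s (X ^ k * P n (m - 1)) := by
    intro n m k
    rw [pow_succ, mul_assoc, hR.X_mul]
    simp only [mul_add, map_add, mul_left_comm _ (C _), moment_C_mul]
  have ortho : ∀ k n m, k < n → moment s (X ^ k * P n m) = 0 := by
    intro k
    induction k with
    | zero =>
      intro n m hn
      obtain ⟨n, rfl⟩ := Nat.exists_eq_add_of_le' hn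
      rw [pow_zero, one_mul, base]
    | succ k ih =>
      intro n m hn
      -- All four neighbours have first index at least n - 1, which still exceeds k.
      rw [hX, ih _ _ (by omega), ih _ _ (by omega), ih _ _ (by omega), ih _ _ (by omega)]
      simp
  refine ⟨s, fun n m k => ortho k n m, fun n m => ?_⟩
  induction n with
  | zero =>
    induction m with
    | zero => simp [hs0]
    | succ m ih =>
      rw [hanti, ortho 0 (0 + 1) m (by omega), zero_add]
      exact mul_ne_zero (sub_ne_zero.2 (hcd 0 m)) ih
  | succ n ih =>
    rw [hX, ortho n _ _ (by omega), ortho n _ _ (by omega), ortho n (n + 1) (m - 1) (by omega),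
      Nat.add_sub_cancel, mul_zero, mul_zero, zero_add, zero_add, add_zero]
    exact mul_ne_zero (hR.2.2.1 _ _ (by omega)) ih

end Favard

/-! ### Recovering the entries from the functionals -/

/-- An admissible family with zero curvature corresponds to a perfect system. -/
theorem Entries.ZeroCurvature.exists_isPerfect {T : Entries} (hT : T.ZeroCurvature)
    (hA : T.Admissible) : ∃ s : Fin 2 → ℕ → ℂ, IsPerfect s ∧ Corresponds T s := by
  have hflat := T.zeroCurvature_iff.1 hT
  have hR := hT.satisfiesRecurrences hA
  set P : ℕ → ℕ → ℂ[X] := fun n m => T.wave n m 0 with hPdef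
  have h00 : P 0 0 = 1 := by simp [hPdef, Entries.wave]
  have hmd := hR.monic_and_natDegree h00
  have hcd : ∀ n m, T.c n m ≠ T.d n m := by
    intro n m h
    -- If c = d, the `α₄` relation reduces to `α₄ (n + 1) m = 0`, against invertibility of `L`.
    have h4 := (hflat n m).eq_α₄
    rw [neg_injective h] at h4
    exact hA.α₄_ne n m (left_eq_add.1 h4)
  obtain ⟨s₀, ortho₀, ne₀⟩ := hR.exists_moment h00 hcd
  obtain ⟨s₁, ortho₁, ne₁⟩ := hR.swap.exists_moment h00 fun n m => (hcd m n).symm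
  let s : Fin 2 → ℕ → ℂ := ![s₀, s₁]
  have hP : IsHermitePadeTable s P := fun n m => ⟨(hmd n m).1, (isSolution_iff _ _ _ _).2
    ⟨(hmd n m).2.le, fun k hk => ortho₀ n m k hk, fun k hk => ortho₁ m n k hk⟩⟩
  have h0 : ∀ n m, moment (s 0) (X ^ n * P n m) ≠ 0 := ne₀
  have h1 : ∀ n m, moment (s 1) (X ^ m * P n m) ≠ 0 := fun n m => ne₁ m n
  -- A step in m multiplies both `α₂` and the moment by c - d, so their ratio can be read off at m =
  -- 0.
  have hα₂ : ∀ n m, T.α₂ n m = moment (s 0) (X ^ n * P n m)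
      / (moment (s 0) (X ^ n * P n 0) / T.α₂ n 0) := by
    intro n m
    have g0 := h0 n 0
    have g2 := hA.α₂_ne n 0
    induction m with
    | zero => field_simp
    | succ m ih =>
      have e1 := (hflat n m).trace
      have e3 := (hflat n m).eq_α₂
      rw [hR.moment_zero_succ_right hP, mul_div_assoc, ← ih, Entries.c, Entries.d]
      linear_combination e3 - T.α₂ n m * e1
  have hα₃ : ∀ n m, T.α₃ n m = moment (s 1) (X ^ m * P n m)
      / (moment (s 1) (X ^ m * P 0 m) / T.α₃ 0 m) := by
    intro n m
    have g1 := h1 0 m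
    have g3 := hA.α₃_ne 0 m
    induction n with
    | zero => field_simp
    | succ n ih =>
      have e1 := (hflat n m).trace
      have e4 := (hflat n m).eq_α₃
      rw [hR.moment_one_succ_left hP, mul_div_assoc, ← ih, Entries.c, Entries.d]
      linear_combination T.α₃ n m * e1 - e4
  refine ⟨s, hP.isPerfect (fun n m => (hmd n m).2) h0 h1, P, hP, hR,
    fun n => moment (s 0) (X ^ n * P n 0) / T.α₂ n 0,
    fun m => moment (s 1) (X ^ m * P 0 m) / T.α₃ 0 m,
    fun n => div_ne_zero (h0 n 0) (hA.α₂_ne n 0), fun m => div_ne_zero (h1 0 m) (hA.α₃_ne 0 m), ?_⟩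
  simp only [remainderCoeff_eq_moment]
  refine ⟨h0, h1, hα₂, hα₃, fun n m => ?_, fun n m => ?_⟩
  -- The moment at (n+1, m) is `T.a (n + 1) m` times that at (n, m), and `T.a` is minus the product
  -- of `α₄` and `α₂`; cancelling `α₂` leaves the formula for `α₄`.
  · have e := hα₂ (n + 1) m
    have hp := div_ne_zero (h0 (n + 1) 0) (hA.α₂_ne (n + 1) 0)
    have g := h0 n m
    have g' := hA.α₂_ne (n + 1) m
    have r := hR.moment_zero_succ_left hP n m
    rw [Entries.a] at r
    rw [r, eq_div_iff hp] at e
    rw [← neg_div, eq_div_iff g]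
    apply mul_left_cancel₀ g'
    linear_combination e
  · have e := hα₃ n (m + 1)
    have hq := div_ne_zero (h1 0 (m + 1)) (hA.α₃_ne 0 (m + 1))
    have g := h1 n m
    have g' := hA.α₃_ne n (m + 1)
    have r := hR.moment_one_succ_right hP n m
    rw [Entries.b] at r
    rw [r, eq_div_iff hq] at e
    rw [← neg_div, eq_div_iff g]
    apply mul_left_cancel₀ g'
    linear_combination e

end HermitePade

end

open HermitePade in
/-- The three parts: for given matrices, zero curvature is equivalent to the existence of a
corresponding perfect system; the same equivalence in terms of the recurrence coefficients alone;
and every perfect system arises. -/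
theorem theorem1 :
    (∀ T : Entries, T.Admissible →
      (T.ZeroCurvature ↔ ∃ s : Fin 2 → ℕ → ℂ, IsPerfect s ∧ Corresponds T s)) ∧
    (∀ a b c d : ℕ → ℕ → ℂ,
      (∃ T : Entries, T.Admissible ∧ T.ZeroCurvature ∧
          T.a = a ∧ T.b = b ∧ T.c = c ∧ T.d = d) ↔
        ∃ s : Fin 2 → ℕ → ℂ, IsPerfect s ∧
          ∃ P : ℕ → ℕ → Polynomial ℂ, IsHermitePadeTable s P ∧
            SatisfiesRecurrences a b c d P) ∧
    (∀ s : Fin 2 → ℕ → ℂ, IsPerfect s →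
      ∃ T : Entries, T.Admissible ∧ T.ZeroCurvature ∧ Corresponds T s) := by
  refine ⟨fun T hA => ⟨fun hT => hT.exists_isPerfect hA, ?_⟩, fun a b c d => ⟨?_, ?_⟩,
    fun s hs => ?_⟩
  · rintro ⟨s, hs, hT⟩
    exact hs.zeroCurvature hT
  · rintro ⟨T, hA, hT, rfl, rfl, rfl, rfl⟩
    obtain ⟨s, hs, P, hP, hR, -⟩ := hT.exists_isPerfect hA
    exact ⟨s, hs, P, hP, hR⟩
  · rintro ⟨s, hs, P, hP, hR⟩
    obtain ⟨T, hA, ha, hb, hc, hd, hT⟩ := hs.exists_entries hP hR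
    exact ⟨T, hA, hs.zeroCurvature hT, ha, hb, hc, hd⟩
  · obtain ⟨P, hP⟩ := exists_isHermitePadeTable s
    obtain ⟨a, b, c, d, hR⟩ := hs.exists_recurrences hP
    obtain ⟨T, hA, -, -, -, -, hT⟩ := hs.exists_entries hP hR
    exact ⟨T, hA, hs.zeroCurvature hT, hT⟩
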